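/- \textbf{Setting.} Let $E$ be a finite-dimensional Euclidean vector space and $W_{\mathrm{aff}}$ an affine Weyl group on $E$, i.e. a (not necessarily discrete) group of affine isometries generated by reflections whose group $W$ of linear parts is finite. Let $\sigma_{\mathrm{mod}}=S(E)/W$ be the model Weyl chamber, the quotient of the unit sphere $S(E)$ of $E$, with the faces induced by the walls of $W$. The map $u\mapsto -u$ induces the antipodal involution $\iota$ of $\sigma_{\mathrm{mod}}$. Let $\chi$ be a Euclidean $\mathbb{R}$-building modelled on $(E,W_{\mathrm{aff}})$ in the sense of Kleiner and Leeb: a complete CAT(0) space with $\sigma_{\mathrm{mod}}$-valued directions $\theta(xy)$ of nontrivial segments and an atlas of isometric charts $E\to\chi$, closed under precomposition with $W_{\mathrm{aff}}$, such that (1) $d(\theta(xy),\theta(xz))$ is at most the comparison angle of $y,z$ at $x$; (2) the angle at $x$ between $xy$ and $xz$ is one of the finitely many distances in $S(E)$ between points of types $\theta(xy)$ and $\theta(xz)$; (3) charts preserve directions, and every segment, ray and line lies in an apartment (the image of a chart); (4) coordinate changes are restrictions of elements of $W_{\mathrm{aff}}$. Let $\theta:\partial_\infty\chi\to\sigma_{\mathrm{mod}}$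 be the type map; simplices of $\partial_\infty\chi$ are the images, under the boundary maps of charts, of the closed faces of $S(E)$. Fix a face $\tau_{\mathrm{mod}}$ of $\sigma_{\mathrm{mod}}$ and a compact subset $\Theta\subset\sigma_{\mathrm{mod}}$. Let $\mathrm{ost}(\tau_{\mathrm{mod}})$ be the union of the open faces of $\sigma_{\mathrm{mod}}$ whose closure meets the interior of $\tau_{\mathrm{mod}}$. For a simplex $\tau$ of $\partial_\infty\chi$ let $\mathrm{st}(\tau)$ be the union of the simplices that meet the interior of $\tau$, and $\mathrm{st}_\Theta(\tau)=\mathrm{st}(\tau)\cap\theta^{-1}(\Theta)$. For $A\subset\partial_\infty\chi$ let $V(x,A)$ be the union of the rays $x\xi$ with $\xi\in A$. A nontrivial segment $xy$ is $\Theta$-regular if it extends beyond $y$ to a ray $x\xi$ with $\theta(\xi)\in\Theta$. A $\Theta$-diamond of a $\Theta$-regular segment $xy$ is a set $$\Diamond_\Theta(xy)=V(x,\mathrm{st}_\Theta(\tau_+))\cap V(y,\mathrm{st}_\Theta(\tau_-)),$$ where $\tau_+$ is a simplex of type $\tau_{\mathrm{mod}}$ such that $xy$ extends beyond $y$ to a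 ray $x\xi$ with $\theta(\xi)\in\mathrm{ost}(\tau_{\mathrm{mod}})$ and $\xi\in\mathrm{st}(\tau_+)$, and $\tau_-$ is obtained in the same way from $yx$ and the face $\iota(\tau_{\mathrm{mod}})$. For an interval $I\subset\mathbb{R}$, a map $p$ from $I$ to a metric space is an $(L,A)$-quasi-geodesic if $L^{-1}|s-t|-A\le d(p(s),p(t))\le L|s-t|+A$ for all $s,t\in I$. An $(L,A)$-quasi-geodesic $p:I\to\chi$ is $(L,A,\Theta,D)$-Morse if for all $t_1\le t_2$ in $I$ there are a $\Theta$-regular segment $x_1x_2$ with $d(x_i,p(t_i))\le D$ ($i=1,2$) and a $\Theta$-diamond $\Diamond_\Theta(x_1x_2)$ such that every point of $p([t_1,t_2]\cap I)$ is at distance at most $D$ from some point of $\Diamond_\Theta(x_1x_2)$. An isometric action of a finitely generated group $\Gamma$ on $\chi$ is \emph{Morse} if, for the word distance of some finite generating set of $\Gamma$ and for every $x\in\chi$, the orbit map $\gamma\mapsto\gamma x$ sends uniform quasi-geodesics to uniform Morse quasi-geodesics: for all $L,A>0$ there are $L',A',D'>0$ such that the image of every $(L,A)$-quasi-geodesic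 of $\Gamma$ is an $(L',A',\Theta,D')$-Morse quasi-geodesic. \textbf{Lemma.} Let $\Gamma=\langle s_1,\dots,s_k\rangle$ be a finitely generated torsion-free group with a Morse isometric action on the Euclidean $\mathbb{R}$-building $\chi$. Suppose that none of the generators $s_i$ has a fixed point in $\chi$. Then the action is free: if $g\in\Gamma$ and $x\in\chi$ satisfy $gx=x$, then $g=1$. -/

import Mathlib

open scoped NNReal

noncomputable section

/-! ## Hadamard spaces, geodesics, boundary at infinity -/

/-- `c` is a unit speed geodesic on the set of parameters `S`. -/
def IsGeodesicOn {X : Type*} [MetricSpace X] (c : ℝ → X) (S : Set ℝ) : Prop :=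
  ∀ s ∈ S, ∀ t ∈ S, dist (c s) (c t) = |s - t|

/-- Complete geodesic CAT(0) spaces. -/
structure IsHadamardSpace (X : Type*) [MetricSpace X] : Prop where
  complete : CompleteSpace X
  geodesic : ∀ x y : X, ∃ c : ℝ → X,
    IsGeodesicOn c (Set.Icc 0 (dist x y)) ∧ c 0 = x ∧ c (dist x y) = y
  cat_zero : ∀ (c : ℝ → X) (l : ℝ), 0 ≤ l → IsGeodesicOn c (Set.Icc 0 l) →
    ∀ t ∈ Set.Icc (0 : ℝ) 1, ∀ z : X,
      dist z (c (t * l)) ^ 2 ≤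
        (1 - t) * dist z (c 0) ^ 2 + t * dist z (c l) ^ 2 - t * (1 - t) * l ^ 2

/-- The angle at `x` of the Euclidean comparison triangle of `x, y, z` (for `y ≠ x ≠ z`). -/
def comparisonAngle {X : Type*} [MetricSpace X] (x y z : X) : ℝ :=
  Real.arccos ((dist x y ^ 2 + dist x z ^ 2 - dist y z ^ 2) / (2 * dist x y * dist x z))

/-- `α` is the (Alexandrov) angle at `c 0 = c' 0` between the geodesics `c` and `c'`. -/
def HasAngle {X : Type*} [MetricSpace X] (c c' : ℝ → X) (α : ℝ) : Prop :=
  Filter.Tendsto (fun p : ℝ × ℝ => comparisonAngle (c 0) (c p.1) (c' p.2))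
    (nhdsWithin 0 (Set.Ioi 0) ×ˢ nhdsWithin 0 (Set.Ioi 0)) (nhds α)

/-- Unit speed geodesic rays `[0, ∞) → X`. -/
def GeodesicRay (X : Type*) [MetricSpace X] : Type _ := {r : ℝ≥0 → X // Isometry r}

theorem GeodesicRay.zero_ne_one {X : Type*} [MetricSpace X] (r : GeodesicRay X) :
    r.1 0 ≠ r.1 1 := fun h => _root_.zero_ne_one (r.2.injective h)

/-- Two rays are asymptotic if they stay at bounded distance. -/
def asymptoticSetoid (X : Type*) [MetricSpace X] : Setoid (GeodesicRay X) where
  r r₁ r₂ := ∃ C : ℝ, ∀ t : ℝ≥0, dist (r₁.1 t) (r₂.1 t) ≤ C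
  iseqv :=
    { refl := fun r => ⟨0, fun t => by simp⟩
      symm := fun ⟨C, h⟩ => ⟨C, fun t => by rw [dist_comm]; exact h t⟩
      trans := fun ⟨C, h⟩ ⟨C', h'⟩ =>
        ⟨C + C', fun t => (dist_triangle _ _ _).trans (add_le_add (h t) (h' t))⟩ }

/-- The boundary at infinity `∂_∞ X`. -/
abbrev IdealBoundary (X : Type*) [MetricSpace X] : Type _ := Quotient (asymptoticSetoid X)

/-- The endpoint at infinity of a ray. -/
def GeodesicRay.endpoint {X : Type*} [MetricSpace X] (r : GeodesicRay X) : IdealBoundary X :=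
  Quotient.mk (asymptoticSetoid X) r

/-- The Weyl cone `V(x, A)`: the union of the rays from `x` with endpoint in `A`. -/
def weylCone {X : Type*} [MetricSpace X] (x : X) (A : Set (IdealBoundary X)) : Set X :=
  {y | ∃ r : GeodesicRay X, r.1 0 = x ∧ r.endpoint ∈ A ∧ ∃ t : ℝ≥0, r.1 t = y}

/-! ## Euclidean Coxeter complexes -/

section Coxeter

variable {E : Type*} [NormedAddCommGroup E] [InnerProductSpace ℝ E]

/-- Orthogonal reflection in an affine hyperplane (through `p`, with unit normal vector `r`). -/
def IsAffineReflection (g : E ≃ᵃⁱ[ℝ] E) : Prop :=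
  ∃ p r : E, ‖r‖ = 1 ∧ ∀ x : E, g x = x - (2 * inner ℝ r (x - p)) • r

variable (E) in
/-- Affine Weyl groups `W_aff`: groups of affine isometries of `E`, generated by reflections and
with finite group `W` of linear parts. They need not be discrete. -/
structure AffineWeylGroup where
  group : Subgroup (E ≃ᵃⁱ[ℝ] E)
  generated : Subgroup.closure {g | g ∈ group ∧ IsAffineReflection g} = group
  finite_linear : {w : E ≃ₗᵢ[ℝ] E | ∃ g ∈ group, g.linearIsometryEquiv = w}.Finite

namespace AffineWeylGroup

variable (W : AffineWeylGroup E)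

/-- The orbits of the finite linear group `W` on the unit sphere of `E`. -/
def sphereSetoid : Setoid (Metric.sphere (0 : E) 1) where
  r u v := ∃ g ∈ W.group, g.linearIsometryEquiv (u : E) = (v : E)
  iseqv :=
    { refl := fun u => ⟨1, W.group.one_mem, rfl⟩
      symm := by
        rintro u v ⟨g, hg, h⟩
        refine ⟨g⁻¹, W.group.inv_mem hg, ?_⟩
        rw [← h]
        exact g.linearIsometryEquiv.symm_apply_apply (u : E)
      trans := by
        rintro u v w ⟨g, hg, h⟩ ⟨g', hg', h'⟩
        refine ⟨g' * g, W.group.mul_mem hg' hg, ?_⟩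
        rw [← h', ← h]
        rfl }

/-- The model Weyl chamber at infinity `σ_mod`, the quotient of the unit sphere by `W`. -/
abbrev ModelChamber : Type _ := Quotient W.sphereSetoid

/-- The projection of the unit sphere to `σ_mod`. -/
def proj (u : Metric.sphere (0 : E) 1) : W.ModelChamber := Quotient.mk W.sphereSetoid u

/-- The type in `σ_mod` of the direction from `p` to `q`. -/
def direction (p q : E) (h : p ≠ q) : W.ModelChamber :=
  W.proj ⟨‖q - p‖⁻¹ • (q - p), by
    rw [mem_sphere_zero_iff_norm]
    exact norm_smul_inv_norm (𝕜 := ℝ) (sub_ne_zero.mpr h.symm)⟩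

/-- The antipodal involution of `σ_mod`, induced by `u ↦ -u`. -/
def antipode : W.ModelChamber → W.ModelChamber :=
  Quotient.map (fun u => -u) (by
    rintro u v ⟨g, hg, h⟩
    exact ⟨g, hg, by simp [h]⟩)

/-- The finite set `D(δ₁, δ₂)` of spherical distances between points of types `δ₁`, `δ₂`. -/
def angleSet (δ₁ δ₂ : W.ModelChamber) : Set ℝ :=
  {α | ∃ u v : Metric.sphere (0 : E) 1,
    W.proj u = δ₁ ∧ W.proj v = δ₂ ∧ α = InnerProductGeometry.angle (u : E) (v : E)}

/-- The quotient metric of `σ_mod`. -/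
def chamberDist (δ₁ δ₂ : W.ModelChamber) : ℝ := sInf (W.angleSet δ₁ δ₂)

/-- Unit normal vectors of the walls of `W`. -/
def IsRoot (r : E) : Prop :=
  ‖r‖ = 1 ∧ ∃ g ∈ W.group, ∀ x : E, g.linearIsometryEquiv x = x - (2 * inner ℝ r x) • r

/-- The closed face of the spherical Coxeter complex that contains `v` in its interior. -/
def closedFace (v : Metric.sphere (0 : E) 1) : Set (Metric.sphere (0 : E) 1) :=
  {u | ∀ r : E, W.IsRoot r → 0 ≤ inner ℝ r (v : E) → 0 ≤ inner ℝ r (u : E)}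

/-- `F` is a (closed) face of `σ_mod`. -/
def IsFace (F : Set W.ModelChamber) : Prop :=
  ∃ v : Metric.sphere (0 : E) 1, F = W.proj '' W.closedFace v

/-- The open star in `σ_mod` of a face `F`: the points `[u]` such that the closure of the open
face of `[u]` meets the interior of `F`. -/
def openStar (F : Set W.ModelChamber) : Set W.ModelChamber :=
  {δ | ∃ u v : Metric.sphere (0 : E) 1,
    W.proj u = δ ∧ v ∈ W.closedFace u ∧ F = W.proj '' W.closedFace v}

end AffineWeylGroup

end Coxeter

/-! ## Euclidean buildings -/

/-- A Euclidean `ℝ`-building modelled on `(E, W_aff)`, in the sense of Kleiner and Leeb. -/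
structure EuclideanBuilding {E : Type*} [NormedAddCommGroup E] [InnerProductSpace ℝ E]
    (W : AffineWeylGroup E) (X : Type*) [MetricSpace X] where
  hadamard : IsHadamardSpace X
  /-- The direction `θ(xy) ∈ σ_mod` of a nontrivial oriented segment. -/
  dir : ∀ x y : X, x ≠ y → W.ModelChamber
  dir_le : ∀ (x y z : X) (hy : x ≠ y) (hz : x ≠ z),
    W.chamberDist (dir x y hy) (dir x z hz) ≤ comparisonAngle x y z
  /-- Angle rigidity. -/
  angle_rigid : ∀ (x y z : X) (hy : x ≠ y) (hz : x ≠ z) (c c' : ℝ → X),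
    IsGeodesicOn c (Set.Icc 0 (dist x y)) → c 0 = x → c (dist x y) = y →
    IsGeodesicOn c' (Set.Icc 0 (dist x z)) → c' 0 = x → c' (dist x z) = z →
    ∃ α ∈ W.angleSet (dir x y hy) (dir x z hz), HasAngle c c' α
  /-- The atlas; the ranges of the charts are the apartments. -/
  charts : Set (E → X)
  isometry_chart : ∀ φ ∈ charts, Isometry φ
  dir_chart : ∀ (φ : E → X) (hφ : φ ∈ charts) (p q : E) (h : p ≠ q),
    dir (φ p) (φ q) ((isometry_chart φ hφ).injective.ne h) = W.direction p q h
  chart_comp : ∀ φ ∈ charts, ∀ g ∈ W.group, φ ∘ g ∈ charts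
  /-- Segments, rays and lines lie in apartments. -/
  segment_apartment : ∀ (c : ℝ → X) (l : ℝ), 0 ≤ l → IsGeodesicOn c (Set.Icc 0 l) →
    ∃ φ ∈ charts, c '' Set.Icc 0 l ⊆ Set.range φ
  ray_apartment : ∀ r : GeodesicRay X, ∃ φ ∈ charts, Set.range r.1 ⊆ Set.range φ
  line_apartment : ∀ c : ℝ → X, Isometry c → ∃ φ ∈ charts, Set.range c ⊆ Set.range φ
  /-- The coordinate changes are restrictions of elements of `W_aff`. -/
  compatible : ∀ φ ∈ charts, ∀ ψ ∈ charts,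
    ∃ g ∈ W.group, ∀ p q : E, φ p = ψ q → q = g p

/-- The ray `t ↦ φ (t u)` in the apartment of an isometric embedding `φ`. -/
def chartRay {E : Type*} [NormedAddCommGroup E] [InnerProductSpace ℝ E]
    {X : Type*} [MetricSpace X] (φ : E → X) (hφ : Isometry φ) (u : Metric.sphere (0 : E) 1) :
    GeodesicRay X :=
  ⟨fun t => φ ((t : ℝ) • (u : E)), Isometry.of_dist_eq fun s t => by
    have hu : ‖(u : E)‖ = 1 := mem_sphere_zero_iff_norm.mp u.2
    rw [hφ.dist_eq, dist_eq_norm, ← sub_smul, norm_smul, hu, mul_one, NNReal.dist_eq,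
      Real.norm_eq_abs]⟩

/-! ## Quasi-geodesics and word metrics -/

/-- `p : I → Y` is an `(L, A)`-quasi-geodesic for the distance function `d` on `Y`. -/
def IsQuasiGeodesic {Y : Type*} (d : Y → Y → ℝ) (L A : ℝ) (I : Set ℝ) (p : I → Y) : Prop :=
  ∀ s t : I, L⁻¹ * |(s : ℝ) - t| - A ≤ d (p s) (p t) ∧ d (p s) (p t) ≤ L * |(s : ℝ) - t| + A

/-- The word distance on `Γ` for the generating set `T`. -/
def wordDist {Γ : Type*} [Group Γ] (T : Finset Γ) (g h : Γ) : ℝ :=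
  ((sInf {n : ℕ | ∃ l : List Γ,
    (∀ x ∈ l, x ∈ T ∨ x⁻¹ ∈ T) ∧ l.prod = g⁻¹ * h ∧ l.length = n} : ℕ) : ℝ)

/-! ## Simplices at infinity, diamonds, Morse actions -/

namespace EuclideanBuilding

variable {E : Type*} [NormedAddCommGroup E] [InnerProductSpace ℝ E] {W : AffineWeylGroup E}
  {X : Type*} [MetricSpace X] (b : EuclideanBuilding W X)

/-- The type map `θ : ∂_∞ X → σ_mod`: the direction of a ray representing `ξ`
(it is the same for all of them). -/
def idealType (ξ : IdealBoundary X) : W.ModelChamber :=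
  b.dir (ξ.out.1 0) (ξ.out.1 1) ξ.out.zero_ne_one

/-- Closed simplices of `∂_Tits X`: the images of the closed faces of the spherical Coxeter
complex under the boundary maps of the charts. -/
def IsSimplex (τ : Set (IdealBoundary X)) : Prop :=
  ∃ (φ : E → X) (hφ : φ ∈ b.charts) (v : Metric.sphere (0 : E) 1),
    τ = (fun u => (chartRay φ (b.isometry_chart φ hφ) u).endpoint) '' W.closedFace v

/-- The interior of a simplex: the points that lie in no proper face. -/
def simplexInterior (τ : Set (IdealBoundary X)) : Set (IdealBoundary X) :=
  {ξ | ξ ∈ τ ∧ ∀ σ, b.IsSimplex σ → σ ⊆ τ → ξ ∈ σ → σ = τ}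

/-- The star of `τ`: the union of the simplices that meet the interior of `τ`. -/
def star (τ : Set (IdealBoundary X)) : Set (IdealBoundary X) :=
  {ξ | ∃ σ, b.IsSimplex σ ∧ (σ ∩ b.simplexInterior τ).Nonempty ∧ ξ ∈ σ}

/-- The `Θ`-star of `τ`. -/
def thetaStar (Θ : Set W.ModelChamber) (τ : Set (IdealBoundary X)) : Set (IdealBoundary X) :=
  b.star τ ∩ b.idealType ⁻¹' Θ

/-- The nontrivial segment `xy` extends to a ray `xξ` with type `θ(ξ) ∈ Θ`. -/
def IsRegularSegment (Θ : Set W.ModelChamber) (x y : X) : Prop :=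
  ∃ r : GeodesicRay X, r.1 0 = x ∧ (∃ t : ℝ≥0, 0 < t ∧ r.1 t = y) ∧ b.idealType r.endpoint ∈ Θ

/-- `τ = τ(xy)` for the face `F = τ_mod` of `σ_mod`: the segment `xy` extends to a ray `xξ`
such that `ξ` is `F`-regular, and `τ` is the simplex of type `F` with `ξ ∈ st(τ)`. -/
def IsForwardSimplex (F : Set W.ModelChamber) (x y : X) (τ : Set (IdealBoundary X)) : Prop :=
  ∃ r : GeodesicRay X, r.1 0 = x ∧ (∃ t : ℝ≥0, 0 < t ∧ r.1 t = y) ∧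
    b.idealType r.endpoint ∈ W.openStar F ∧
    b.IsSimplex τ ∧ b.idealType '' τ = F ∧ r.endpoint ∈ b.star τ

/-- `Q` is the `Θ`-diamond of the `Θ`-regular segment `xy`. The simplex `τ(yx)` of the reversed
segment has the opposite type, which is again `F` when `F` is invariant under the antipodal
involution. -/
def IsDiamond (F Θ : Set W.ModelChamber) (x y : X) (Q : Set X) : Prop :=
  b.IsRegularSegment Θ x y ∧
  ∃ τ₁ τ₂ : Set (IdealBoundary X),
    b.IsForwardSimplex F x y τ₁ ∧ b.IsForwardSimplex (W.antipode '' F) y x τ₂ ∧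
    Q = weylCone x (b.thetaStar Θ τ₁) ∩ weylCone y (b.thetaStar Θ τ₂)

/-- `(L, A, Θ, D)`-Morse quasi-geodesics. -/
def IsMorseQuasiGeodesic (F Θ : Set W.ModelChamber) (L A D : ℝ) (I : Set ℝ) (p : I → X) :
    Prop :=
  IsQuasiGeodesic dist L A I p ∧
  ∀ t₁ t₂ : I, t₁ ≤ t₂ → ∃ (x₁ x₂ : X) (Q : Set X), b.IsDiamond F Θ x₁ x₂ Q ∧
    dist x₁ (p t₁) ≤ D ∧ dist x₂ (p t₂) ≤ D ∧
    ∀ t : I, t₁ ≤ t → t ≤ t₂ → ∃ y ∈ Q, dist (p t) y ≤ D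

/-- `f` sends uniform quasi-geodesics of `(Y, d)`, defined on intervals, to uniform Morse
quasi-geodesics. -/
def IsMorseEmbedding (F Θ : Set W.ModelChamber) {Y : Type*} (d : Y → Y → ℝ) (f : Y → X) : Prop :=
  ∀ L A : ℝ, 0 < L → 0 < A → ∃ L' A' D' : ℝ, 0 < L' ∧ 0 < A' ∧ 0 < D' ∧
    ∀ (I : Set ℝ) (p : I → Y), I.OrdConnected → IsQuasiGeodesic d L A I p →
      b.IsMorseQuasiGeodesic F Θ L' A' D' I (f ∘ p)

/-- The isometric action `ρ` is Morse: for some word distance on `Γ`, the orbit maps are Morse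
embeddings. -/
def IsMorseAction (F Θ : Set W.ModelChamber) {Γ : Type*} [Group Γ] (ρ : Γ →* (X ≃ᵢ X)) : Prop :=
  ∃ T : Finset Γ, Subgroup.closure (T : Set Γ) = ⊤ ∧
    ∀ x : X, b.IsMorseEmbedding F Θ (wordDist T) (fun γ => ρ γ x)

end EuclideanBuilding

end

/-!
The orbit map of a Morse action is a quasi-isometric embedding of `Γ`: a geodesic word for `h`
traces a quasi-geodesic of `Γ` from `1` to `h` with constants independent of `h`
(`exists_isQuasiGeodesic_wordLength`), and the Morse property says that its image in `X` is a
quasi-geodesic with uniform constants `(L', A')`. Comparing the endpoints gives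
`|h| ≤ L' (d(x, h x) + A')` (`EuclideanBuilding.IsMorseAction.exists_wordLength_le`).

Hence the elements of a point stabilizer have bounded word length. Balls of a finitely generated
group are finite (`finite_wordLength_le`), so point stabilizers are finite. A stabilizer contains
all powers of each of its elements `g`, so `g` has finite order, and `g = 1` as `Γ` is torsion-free.
-/

/-! ### Word length in a finitely generated group -/

section WordLength

variable {Γ : Type*} [Group Γ] {T : Finset Γ}

/-- `l` is a word in the elements of `T` and their inverses. -/
def IsWord (T : Finset Γ) (l : List Γ) : Prop := ∀ x ∈ l, x ∈ T ∨ x⁻¹ ∈ T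

theorem IsWord.append {l l' : List Γ} (h : IsWord T l) (h' : IsWord T l') :
    IsWord T (l ++ l') := fun x hx => (List.mem_append.1 hx).elim (h x) (h' x)

theorem IsWord.take {l : List Γ} (h : IsWord T l) (n : ℕ) : IsWord T (l.take n) :=
  fun x hx => h x (List.mem_of_mem_take hx)

theorem IsWord.drop {l : List Γ} (h : IsWord T l) (n : ℕ) : IsWord T (l.drop n) :=
  fun x hx => h x (List.mem_of_mem_drop hx)

theorem IsWord.reverse_map_inv {l : List Γ} (h : IsWord T l) :
    IsWord T (l.map (·⁻¹)).reverse := by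
  intro x hx
  obtain ⟨y, hy, rfl⟩ := List.mem_map.1 (List.mem_reverse.1 hx)
  simpa [or_comm] using h y hy

/-- The word length of `h` for the generating set `T`. It takes the junk value `0` when `h` is not
in the subgroup generated by `T`. -/
noncomputable def wordLength (T : Finset Γ) (h : Γ) : ℕ :=
  sInf {n : ℕ | ∃ l : List Γ, IsWord T l ∧ l.prod = h ∧ l.length = n}

theorem wordDist_eq_wordLength (g h : Γ) : wordDist T g h = wordLength T (g⁻¹ * h) := rfl

theorem wordLength_prod_le {l : List Γ} (hl : IsWord T l) : wordLength T l.prod ≤ l.length :=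
  Nat.sInf_le ⟨l, hl, rfl, rfl⟩

theorem exists_isWord_length_eq_wordLength (hT : Subgroup.closure (T : Set Γ) = ⊤) (h : Γ) :
    ∃ l : List Γ, IsWord T l ∧ l.prod = h ∧ l.length = wordLength T h := by
  apply Nat.sInf_mem (s := {n : ℕ | ∃ l : List Γ, IsWord T l ∧ l.prod = h ∧ l.length = n})
  have hh : h ∈ (Subgroup.closure (T : Set Γ)).toSubmonoid := by simp [hT]
  rw [Subgroup.closure_toSubmonoid] at hh
  obtain ⟨l, hl, hp⟩ := Submonoid.exists_list_of_mem_closure hh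
  exact ⟨l.length, l, hl, hp, rfl⟩

theorem wordLength_inv_le (hT : Subgroup.closure (T : Set Γ) = ⊤) (h : Γ) :
    wordLength T h⁻¹ ≤ wordLength T h := by
  obtain ⟨l, hl, rfl, hlen⟩ := exists_isWord_length_eq_wordLength hT h
  rw [← hlen, List.prod_inv_reverse]
  simpa using wordLength_prod_le hl.reverse_map_inv

theorem wordLength_inv (hT : Subgroup.closure (T : Set Γ) = ⊤) (h : Γ) :
    wordLength T h⁻¹ = wordLength T h :=
  (wordLength_inv_le hT h).antisymm (by simpa using wordLength_inv_le hT h⁻¹)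

theorem wordDist_comm (hT : Subgroup.closure (T : Set Γ) = ⊤) (g h : Γ) :
    wordDist T g h = wordDist T h g := by
  rw [wordDist_eq_wordLength, wordDist_eq_wordLength, ← wordLength_inv hT]
  simp

theorem finite_wordLength_le (hT : Subgroup.closure (T : Set Γ) = ⊤) (n : ℕ) :
    {h : Γ | wordLength T h ≤ n}.Finite := by
  have hfin : Finite {x : Γ // x ∈ T ∨ x⁻¹ ∈ T} := by
    refine Set.Finite.to_subtype (s := {x : Γ | x ∈ T ∨ x⁻¹ ∈ T}) ?_
    exact T.finite_toSet.union (T.finite_toSet.preimage inv_injective.injOn)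
  refine ((List.finite_length_le {x : Γ // x ∈ T ∨ x⁻¹ ∈ T} n).image
    fun l => (l.map Subtype.val).prod).subset fun h hh => ?_
  obtain ⟨l, hl, rfl, hlen⟩ := exists_isWord_length_eq_wordLength hT h
  have hl' : ∀ x ∈ l, x ∈ T ∨ x⁻¹ ∈ T := hl
  refine ⟨l.attachWith _ hl', ?_, congrArg List.prod (List.attachWith_map_subtype_val hl')⟩
  simpa [hlen] using hh

/-! ### Geodesic words -/

/-- A subword of a geodesic word is geodesic: replacing it by a shorter one would shorten the
whole word. -/
theorem wordDist_prod_take (hT : Subgroup.closure (T : Set Γ) = ⊤) {l : List Γ} (hl : IsWord T l)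
    (hlen : l.length = wordLength T l.prod) {a b : ℕ} (hab : a ≤ b) (hb : b ≤ l.length) :
    wordDist T (l.take a).prod (l.take b).prod = (b : ℝ) - a := by
  have hsplit : (l.take b).prod = (l.take a).prod * ((l.take b).drop a).prod := by
    conv_lhs => rw [← List.take_append_drop a (l.take b), List.prod_append, List.take_take,
      min_eq_left hab]
  rw [wordDist_eq_wordLength, ← Nat.cast_sub hab, Nat.cast_inj, hsplit, inv_mul_cancel_left]
  apply le_antisymm
  · refine (wordLength_prod_le ((hl.take b).drop a)).trans ?_
    simp [hb]
  · obtain ⟨m, hm, hmp, hmlen⟩ :=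
      exists_isWord_length_eq_wordLength hT ((l.take b).drop a).prod
    have hprod : (l.take a ++ m ++ l.drop b).prod = l.prod := by
      rw [List.prod_append, List.prod_append, hmp, ← hsplit, List.prod_take_mul_prod_drop]
    have hle := wordLength_prod_le (((hl.take a).append hm).append (hl.drop b))
    rw [hprod, ← hlen] at hle
    simp only [List.length_append, List.length_take, List.length_drop] at hle
    omega

/-- Every group element is joined to `1` by a `(1, 1)`-quasi-geodesic parametrized by an interval
whose length is the word length: round the parameter down and take prefixes of a geodesic word. -/
theorem exists_isQuasiGeodesic_wordLength (hT : Subgroup.closure (T : Set Γ) = ⊤) (h : Γ) :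
    ∃ p : Set.Icc (0 : ℝ) (wordLength T h) → Γ,
      IsQuasiGeodesic (wordDist T) 1 1 (Set.Icc (0 : ℝ) (wordLength T h)) p ∧
      p ⟨0, by simp⟩ = 1 ∧ p ⟨wordLength T h, by simp⟩ = h := by
  obtain ⟨l, hl, rfl, hlen⟩ := exists_isWord_length_eq_wordLength hT h
  refine ⟨fun t => (l.take ⌊(t : ℝ)⌋₊).prod, ?_, by simp, by simp [← hlen]⟩
  have key : ∀ s t : Set.Icc (0 : ℝ) (wordLength T l.prod), (s : ℝ) ≤ t →
      |wordDist T (l.take ⌊(s : ℝ)⌋₊).prod (l.take ⌊(t : ℝ)⌋₊).prod - abs ((s : ℝ) - t)| ≤ 1 := by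
    rintro ⟨s, hs⟩ ⟨t, ht⟩ (hst : s ≤ t)
    have hb : ⌊t⌋₊ ≤ l.length := by
      rw [hlen]
      exact Nat.floor_le_of_le ht.2
    rw [wordDist_prod_take hT hl hlen (Nat.floor_le_floor hst) hb, abs_sub_comm s t,
      abs_of_nonneg (sub_nonneg.2 hst), abs_le]
    have h1 := Nat.floor_le hs.1
    have h2 := Nat.lt_floor_add_one s
    have h3 := Nat.floor_le ht.1
    have h4 := Nat.lt_floor_add_one t
    constructor <;> linarith
  intro s t
  have hkey : |wordDist T (l.take ⌊(s : ℝ)⌋₊).prod (l.take ⌊(t : ℝ)⌋₊).prod -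
      abs ((s : ℝ) - t)| ≤ 1 := by
    rcases le_total (s : ℝ) t with hst | hst
    · exact key s t hst
    · rw [wordDist_comm hT, abs_sub_comm (s : ℝ)]
      exact key t s hst
  rw [abs_le] at hkey
  constructor <;> linarith

end WordLength

/-! ### Morse actions -/

/-- The lower bound in the statement that orbit maps of Morse actions are quasi-isometric
embeddings. -/
theorem EuclideanBuilding.IsMorseAction.exists_wordLength_le
    {E : Type*} [NormedAddCommGroup E] [InnerProductSpace ℝ E] {W : AffineWeylGroup E}
    {X : Type*} [MetricSpace X] {b : EuclideanBuilding W X} {F Θ : Set W.ModelChamber}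
    {Γ : Type*} [Group Γ] {ρ : Γ →* (X ≃ᵢ X)} (hρ : b.IsMorseAction F Θ ρ) :
    ∃ T : Finset Γ, Subgroup.closure (T : Set Γ) = ⊤ ∧
      ∀ x : X, ∃ L A : ℝ, ∀ h : Γ, (wordLength T h : ℝ) ≤ L * (dist x (ρ h x) + A) := by
  obtain ⟨T, hT, hmorse⟩ := hρ
  refine ⟨T, hT, fun x => ?_⟩
  obtain ⟨L, A, D, hL, -, -, hqg⟩ := hmorse x 1 1 one_pos one_pos
  refine ⟨L, A, fun h => ?_⟩
  obtain ⟨p, hp, hp0, hp1⟩ := exists_isQuasiGeodesic_wordLength hT h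
  have hends := ((hqg _ p Set.ordConnected_Icc hp).1 ⟨0, by simp⟩ ⟨wordLength T h, by simp⟩).1
  simp only [Function.comp_apply, hp0, hp1, map_one, IsometryEquiv.coe_one, id_eq, zero_sub,
    abs_neg, Nat.abs_cast] at hends
  rw [← inv_mul_le_iff₀ hL]
  linarith

/-- Point stabilizers of Morse actions are finite. -/
theorem EuclideanBuilding.IsMorseAction.finite_stabilizer
    {E : Type*} [NormedAddCommGroup E] [InnerProductSpace ℝ E] {W : AffineWeylGroup E}
    {X : Type*} [MetricSpace X] {b : EuclideanBuilding W X} {F Θ : Set W.ModelChamber}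
    {Γ : Type*} [Group Γ] {ρ : Γ →* (X ≃ᵢ X)} (hρ : b.IsMorseAction F Θ ρ) (x : X) :
    {h : Γ | ρ h x = x}.Finite := by
  obtain ⟨T, hT, hbound⟩ := hρ.exists_wordLength_le
  obtain ⟨L, A, hLA⟩ := hbound x
  refine (finite_wordLength_le hT ⌊L * A⌋₊).subset fun h (hh : ρ h x = x) => Nat.le_floor ?_
  simpa [hh] using hLA h

theorem mainTheorem3
    {E : Type*} [NormedAddCommGroup E] [InnerProductSpace ℝ E] [FiniteDimensional ℝ E]
    (W : AffineWeylGroup E) {X : Type*} [MetricSpace X] (b : EuclideanBuilding W X)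
    (F : Set W.ModelChamber) (hF : W.IsFace F)
    (Θ : Set W.ModelChamber) (hΘ : IsCompact Θ)
    {Γ : Type*} [Group Γ] (htf : ∀ g : Γ, g ≠ 1 → ¬ IsOfFinOrder g)
    {k : ℕ} (s : Fin k → Γ) (hs : Subgroup.closure (Set.range s) = ⊤)
    (ρ : Γ →* (X ≃ᵢ X)) (hρ : b.IsMorseAction F Θ ρ)
    (hfix : ∀ (i : Fin k) (x : X), ρ (s i) x ≠ x) :
    ∀ (g : Γ) (x : X), ρ g x = x → g = 1 := by
  intro g x hg
  by_contra hne
  have hpow : ∀ n : ℕ, ρ (g ^ n) x = x := by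
    intro n
    induction n with
    | zero => simp
    | succ n ih => rw [pow_succ, map_mul, IsometryEquiv.mul_apply, hg, ih]
  exact Set.infinite_of_injective_forall_mem (injective_pow_iff_not_isOfFinOrder.2 (htf g hne))
    hpow (hρ.finite_stabilizer x)
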